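/- An ordered rooted tree is a finite rooted tree (at least one node) in which the children of every node are linearly ordered. A generator of such a tree is a leaf (node of outdegree $0$) or a node of outdegree $1$. For $n\ge 1$ let $\mathcal{T}_n$ be the set of ordered rooted trees with exactly $n$ generators. Let $(s_m)_{m\ge 0}=1,1,3,11,45,197,\dots$ be the little Schröder numbers (OEIS A001003), and let $\mathfrak{D}^{\mathbf s}_n$ be the set of Dyck paths of semilength $n$ in which every ascent (maximal run of up-steps) of length $j$ is colored with one of $s_{j-1}$ colors. For $0\le k\le n$ let $$B_{n,k}(z_1,\dots,z_{n-k+1})=\sum_{\alpha}\frac{n!}{\alpha_1!\alpha_2!\cdots}\Big(\frac{z_1}{1!}\Big)^{\alpha_1}\Big(\frac{z_2}{2!}\Big)^{\alpha_2}\cdots$$ be the partial Bell polynomial, the sum being over all $\alpha\in\mathbb{N}_0^{\,n-k+1}$ with $\sum_i\alpha_i=k$ and $\sum_i i\,\alpha_i=n$. Then for every $n\ge 1$ the sets $\mathcal{T}_n$ and $\mathfrak{D}^{\mathbf s}_n$ are finite and $$\#\mathcal{T}_n=\#\mathfrak{D}^{\mathbf s}_n=1+\sum_{k=1}^{n-1}\sum_{j=1}^{n-k}\frac1j\binom{n}{k-1}\binom{n-k-1}{j-1}\binom{n+j-1}{j-1}.$$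 For $n=1,\dots,8$ these numbers are $1,2,7,32,166,926,5419,32816$. Moreover, for every $n\ge1$ and $k\ge 1$, the number of trees in $\mathcal{T}_n$ with exactly $k-1$ nodes of outdegree $1$ equals the number of paths in $\mathfrak{D}^{\mathbf s}_n$ with exactly $k$ peaks (up-steps immediately followed by a down-step). For $1\le k\le n$ this number is $$\binom{n}{k-1}\frac{(k-1)!}{n!}\,B_{n,k}(1!s_0,2!s_1,3!s_2,\dots),$$ and for $1\le k<n$ it equals $$\binom{n}{k-1}\sum_{j=1}^{n-k}\frac1j\binom{n-k-1}{j-1}\binom{n+j-1}{j-1}.$$ -/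

import Mathlib

/-- Finite ordered rooted trees: a root together with the (possibly empty) ordered list of the
subtrees hanging from its children. -/
inductive OrderedTree : Type
  | node (children : List OrderedTree) : OrderedTree

namespace OrderedTree

/-- The list of the outdegrees (numbers of children) of all nodes of a tree, one entry for each
node, in preorder. -/
def outdegrees : OrderedTree → List ℕ
  | node ts => ts.length :: ts.flatMap fun t => t.outdegrees

/-- The number of generators of a tree; a generator is a leaf (a node of outdegree `0`) or a node
of outdegree `1`. -/
def numGenerators (t : OrderedTree) : ℕ :=
  t.outdegrees.countP fun d => d = 0 ∨ d = 1

/-- The number of nodes of outdegree `1`. -/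
def numUnary (t : OrderedTree) : ℕ :=
  t.outdegrees.count 1

/-- The set of ordered rooted trees with `n` generators. -/
def withGenerators (n : ℕ) : Set OrderedTree :=
  {t | t.numGenerators = n}

end OrderedTree

/-- The little Schröder numbers `s 0, s 1, s 2, … = 1, 1, 3, 11, 45, 197, …` (OEIS A001003).
The index of Mathlib's sequence `Nat.smallSchroder`, which reads `1, 1, 1, 3, 11, …`, is larger
by one. -/
def littleSchroder (n : ℕ) : ℕ :=
  Nat.smallSchroder (n + 1)

/-- The lengths of the ascents (maximal runs of up-steps) of a Dyck path, from left to right: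
cut the word at every down-step and discard the empty pieces. -/
def dyckAscents (p : DyckWord) : List ℕ :=
  ((p.toList.splitOn DyckStep.D).map List.length).filter fun j => 0 < j

/-- The number of peaks of a Dyck path: the number of up-steps immediately followed by a
down-step. -/
def dyckPeaks (p : DyckWord) : ℕ :=
  (p.toList.zip p.toList.tail).count (DyckStep.U, DyckStep.D)

/-- A Dyck path in which every ascent of length `j` carries one of `c j` colors. -/
structure ColoredDyckPath (c : ℕ → ℕ) where
  /-- The underlying Dyck path. -/
  path : DyckWord
  /-- The colors of its ascents. -/
  color : (i : Fin (dyckAscents path).length) → Fin (c ((dyckAscents path).get i))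

/-- The set of Dyck paths of semilength `n` in which every ascent of length `j` carries one of
`s (j - 1)` colors, where `s` is the sequence of little Schröder numbers. (Ascents have positive
length.) -/
def schroderDyckPaths (n : ℕ) : Set (ColoredDyckPath fun j => littleSchroder (j - 1)) :=
  {P | P.path.semilength = n}

/-- The value `B_{n,k}(z 1, …, z (n - k + 1))` of the partial exponential Bell polynomial, for
`k ≤ n`: the sum of `n! / (α₁! α₂! ⋯) * (z 1 / 1!) ^ α₁ * (z 2 / 2!) ^ α₂ * ⋯` over all
multi-indices `α` on `{1, …, n - k + 1}` with `∑ αᵢ = k` and `∑ i * αᵢ = n`. -/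
def partialBell (n k : ℕ) (z : ℕ → ℚ) : ℚ :=
  ∑ α ∈ (Finset.piAntidiag (Finset.Icc 1 (n - k + 1)) k).filter
      (fun α : ℕ → ℕ => ∑ i ∈ Finset.Icc 1 (n - k + 1), i * α i = n),
    (n.factorial : ℚ) / (∏ i ∈ Finset.Icc 1 (n - k + 1), ((α i).factorial : ℚ)) *
      ∏ i ∈ Finset.Icc 1 (n - k + 1), (z i / (i.factorial : ℚ)) ^ α i

/-! Trees and paths are both encoded by Łukasiewicz words. The preorder list of outdegrees
identifies ordered trees with the words in `IsLukasiewicz 1`. The numbers of up-steps between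
consecutive down-steps identify Dyck paths of semilength `n` with such words of length `n + 1`,
whose positive letters are the ascents. Lagrange inversion counts these words with weights on the
letters (`natCast_mul_sum_lukasiewiczWords`).

A tree with `n` generators, `u` of them unary, and `j` branching nodes is a word of length `n + j`;
marking the letters `0` and `1` gives `binom(n,u) * (1/j) * binom(n-u-2,j-1) * binom(n+j-1,j-1)` for
`j ≥ 1` and `u + 2 ≤ n`. For colored paths, marking the positive letters gives `(1/k) * binom(n,k-1)
* [x^n] (x s(x))^k`, with `s` the little Schröder series. Now `A = x s(x)` solves `A = x φ(A)` with
`φ(u) = (1-u)/(1-2u)`, and a second Lagrange inversion turns this coefficient into the tree sum for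
`u = k - 1`. The multinomial theorem turns it into the Bell polynomial. -/

/-! ### Lagrange inversion -/

open Finset in
/-- A doubly indexed sequence with the recurrence of the coefficients of the powers of a power
series `A = X * φ(A)` is given by the Lagrange inversion formula. -/
theorem PowerSeries.lagrange_of_recurrence {R : Type*} [CommRing R] [IsDomain R] [CharZero R]
    (φ : PowerSeries R) (a : ℕ → ℕ → R) (h00 : a 0 0 = 1) (h0 : ∀ N, a 0 (N + 1) = 0)
    (h1 : ∀ r, a (r + 1) 0 = 0)
    (h : ∀ r N, a (r + 1) (N + 1) = ∑ d ∈ range (N + 1), coeff d φ * a (r + d) N) (r N : ℕ) :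
    (N : R) * a r N = r * coeff N (X ^ r * φ ^ N) := by
  induction N generalizing r with
  | zero =>
    cases r with
    | zero => simp
    | succ r => simp [h1]
  | succ N ih =>
    cases r with
    | zero => simp [h0]
    | succ r =>
      -- The general step cancels a factor `N`, so `a (r + 1) 1` is computed directly.
      rcases Nat.eq_zero_or_pos N with rfl | hN
      · cases r with
        | zero => simp [h, h00]
        | succ r =>
          have e : (X : PowerSeries R) ^ (r + 1 + 1) * φ ^ (0 + 1) = X * (X * (X ^ r * φ)) := by
            ring
          rw [e, coeff_succ_X_mul]
          simp [h, h1]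
      have hN' : (N : R) ≠ 0 := by exact_mod_cast hN.ne'
      apply mul_left_cancel₀ hN'
      -- By induction `N * a (r + d) N` carries the factor `r + d`, which the Euler operator `X *
      -- d/dX` produces on the term of degree `r + d` of `X ^ r * φ`; the recurrence becomes a
      -- Cauchy product.
      have key : (N : R) * a (r + 1) (N + 1) =
          coeff N (φ ^ N * (X * derivative R (X ^ r * φ))) := by
        have e1 : ∀ d, coeff (r + d) (X * derivative R (X ^ r * φ)) = (r + d) * coeff d φ := by
          intro d
          rcases hd : r + d with _ | e
          · obtain ⟨rfl, rfl⟩ : r = 0 ∧ d = 0 := by lia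
            simp
          · rw [coeff_succ_X_mul, coeff_derivative, ← hd, add_comm r d, coeff_X_pow_mul]
            have : (r : R) + d = e + 1 := by exact_mod_cast hd
            rw [this, mul_comm]
        have e2 : ∀ d, d < r → coeff d (X * derivative R (X ^ r * φ)) = 0 := by
          intro d hd
          rcases d with _ | d
          · simp
          · rw [coeff_succ_X_mul, coeff_derivative, coeff_X_pow_mul', if_neg (by lia), zero_mul]
        rw [mul_comm (φ ^ N), coeff_mul, h, mul_sum,
          Nat.sum_antidiagonal_eq_sum_range_succ
            (fun i j => coeff i (X * derivative R (X ^ r * φ)) * coeff j (φ ^ N))]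
        have e3 : ∀ d ∈ range (N + 1), (N : R) * (coeff d φ * a (r + d) N) =
            if r + d ≤ N then coeff (r + d) (X * derivative R (X ^ r * φ)) *
              coeff (N - (r + d)) (φ ^ N) else 0 := by
          intro d _
          rw [mul_left_comm, ih, e1, coeff_X_pow_mul']
          split_ifs
          · push_cast; ring
          · simp
        rw [sum_congr rfl e3, ← sum_filter]
        symm
        rw [← sum_filter_of_ne (p := fun i => r ≤ i)]
        · refine sum_bij' (fun i _ => i - r) (fun i _ => r + i) ?_ ?_ ?_ ?_ ?_ <;>
            simp only [mem_filter, mem_range] <;> intros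
          · lia
          · lia
          · lia
          · lia
          · rw [Nat.add_sub_cancel' (by lia)]
        · intro i _ hi
          by_contra hlt
          exact hi (by rw [e2 i (by lia), zero_mul])
      have key2 : (N : R) * coeff N (X ^ r * φ ^ (N + 1)) =
          coeff N (X * derivative R (X ^ r * φ ^ (N + 1))) := by
        obtain ⟨M, rfl⟩ : ∃ M, N = M + 1 := ⟨N - 1, by lia⟩
        rw [coeff_succ_X_mul, coeff_derivative]
        push_cast; ring
      have e4 : (X : PowerSeries R) ^ (r + 1) * φ ^ (N + 1) = X * (X ^ r * φ ^ (N + 1)) := by ring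
      rw [mul_left_comm, key, e4, coeff_succ_X_mul]
      -- By the product rule. In degree `N` the Euler term contributes the factor `N` and the other
      -- term `N * r`, together `N * (r + 1)`.
      have e5 : ((N + 1 : ℕ) : PowerSeries R) * (φ ^ N * (X * derivative R (X ^ r * φ))) =
          X * derivative R (X ^ r * φ ^ (N + 1)) +
            ((N * r : ℕ) : PowerSeries R) * (X ^ r * φ ^ (N + 1)) := by
        rw [Derivation.leibniz, Derivation.leibniz, derivative_pow, derivative_pow]
        rcases r with _ | r
        · simp; ring
        · simp; ring
      have e6 := congrArg (coeff N) e5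
      rw [map_add, ← nsmul_eq_mul, ← nsmul_eq_mul, map_nsmul, map_nsmul, ← key2, nsmul_eq_mul,
        nsmul_eq_mul] at e6
      rw [e6]
      push_cast; ring

open Finset in
/-- **Lagrange inversion** for the powers of the solution of `A = X * φ(A)`. -/
theorem PowerSeries.natCast_mul_coeff_pow_of_eq_X_mul_subst {R : Type*} [CommRing R] [IsDomain R]
    [CharZero R] {φ A : PowerSeries R} (hA : A = X * φ.subst A) (r N : ℕ) :
    (N : R) * coeff N (A ^ r) = r * coeff N (X ^ r * φ ^ N) := by
  have hA0 : constantCoeff A = 0 := by rw [hA]; simp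
  have hs : HasSubst A := HasSubst.of_constantCoeff_zero' hA0
  have hlt : ∀ {d N}, N < d → coeff N (A ^ d) = 0 := by
    intro d N hd
    rw [hA, mul_pow, coeff_X_pow_mul', if_neg (by lia)]
  refine lagrange_of_recurrence φ (fun r N => coeff N (A ^ r)) (by simp) (fun N => by simp)
    (fun r => by simp [hA0]) (fun r N => ?_) r N
  have e : A ^ (r + 1) = X * (φ * X ^ r).subst A := by
    rw [subst_mul hs, subst_pow hs, subst_X hs, ← mul_assoc, ← hA, pow_succ']
  -- The terms below `r` vanish because of the factor `X ^ r`, those above `N` because `X ^ d`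
  -- divides `A ^ d`.
  rw [e, coeff_succ_X_mul, coeff_subst' hs,
    finsum_eq_sum_of_support_subset (s := range (r + (N + 1))), sum_range_add, add_eq_right.mpr]
  · refine sum_congr rfl fun d _ => ?_
    rw [add_comm r d, coeff_mul_X_pow, smul_eq_mul]
  · refine sum_eq_zero fun d hd => ?_
    rw [coeff_mul_X_pow', if_neg (by simpa using hd), zero_smul]
  · intro d hd
    by_contra hlarge
    refine hd ?_
    simp only [coe_range, Set.mem_Iio, not_lt] at hlarge
    simp only [hlt (show N < d by lia), smul_zero]

/-! ### Łukasiewicz words and their weighted enumeration -/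

/-- `IsLukasiewicz r l` says that `l` is the list of the outdegrees, in preorder, of the nodes of
an ordered forest of `r` trees. -/
def IsLukasiewicz : ℕ → List ℕ → Prop
  | r, [] => r = 0
  | 0, _ :: _ => False
  | r + 1, d :: l => IsLukasiewicz (r + d) l

@[simp] theorem isLukasiewicz_nil {r : ℕ} : IsLukasiewicz r [] ↔ r = 0 := by
  cases r <;> simp [IsLukasiewicz]

@[simp] theorem not_isLukasiewicz_zero_cons {d : ℕ} {l : List ℕ} :
    ¬ IsLukasiewicz 0 (d :: l) := by simp [IsLukasiewicz]

@[simp] theorem isLukasiewicz_succ_cons {r d : ℕ} {l : List ℕ} :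
    IsLukasiewicz (r + 1) (d :: l) ↔ IsLukasiewicz (r + d) l := by simp [IsLukasiewicz]

namespace IsLukasiewicz

theorem add_sum_eq_length {r : ℕ} {l : List ℕ} (h : IsLukasiewicz r l) :
    r + l.sum = l.length := by
  induction l generalizing r with
  | nil => simpa using h
  | cons d l ih =>
    cases r with
    | zero => simp at h
    | succ r =>
      have := ih (isLukasiewicz_succ_cons.1 h)
      simp only [List.sum_cons, List.length_cons]
      lia

/-- The last node in preorder is a leaf. Hence every tree has a leaf, and the last run of a Dyck
path is empty. -/
theorem getLast_eq_zero {r : ℕ} {l : List ℕ} (h : IsLukasiewicz r l) (hl : l ≠ []) :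
    l.getLast hl = 0 := by
  induction l generalizing r with
  | nil => simp at hl
  | cons d l ih =>
    cases r with
    | zero => simp at h
    | succ r =>
      rw [isLukasiewicz_succ_cons] at h
      rcases eq_or_ne l [] with rfl | hne
      · simp at h ⊢; lia
      · rw [List.getLast_cons hne]
        exact ih h hne

end IsLukasiewicz

/-- The finite set of the words of length `N` that satisfy `IsLukasiewicz r`. -/
def lukasiewiczWords : ℕ → ℕ → Finset (List ℕ)
  | 0, 0 => {[]}
  | _ + 1, 0 => ∅
  | 0, _ + 1 => ∅
  | r + 1, N + 1 => (Finset.range (N + 1)).biUnion fun d =>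
      (lukasiewiczWords (r + d) N).map ⟨List.cons d, List.cons_injective⟩

theorem mem_lukasiewiczWords {r N : ℕ} {l : List ℕ} :
    l ∈ lukasiewiczWords r N ↔ IsLukasiewicz r l ∧ l.length = N := by
  induction N generalizing r l with
  | zero =>
    cases r <;> cases l <;> simp [lukasiewiczWords]
  | succ N ih =>
    cases r <;> cases l <;> simp [lukasiewiczWords, ih]
    -- The bound on the first letter in the definition loses nothing: a forest with `r + d` roots
    -- has at least `d` nodes.
    rintro h hN
    have := h.add_sum_eq_length
    lia

open Finset in
theorem sum_lukasiewiczWords_succ {R : Type*} [CommSemiring R] (w : ℕ → R) (r N : ℕ) :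
    ∑ l ∈ lukasiewiczWords (r + 1) (N + 1), (l.map w).prod =
      ∑ d ∈ range (N + 1), w d * ∑ l ∈ lukasiewiczWords (r + d) N, (l.map w).prod := by
  rw [lukasiewiczWords, sum_biUnion]
  · simp [mul_sum]
  · intro d _ e _ hde
    simp only [Function.onFun, disjoint_left, mem_map, not_exists, not_and]
    rintro _ ⟨l, _, rfl⟩ l' _ h
    exact hde (List.cons.inj h).1.symm

/-- The weighted number of ordered trees with `N` nodes, where a node of outdegree `d` has the
weight `w d`, is the coefficient of `u ^ (N - 1)` in `(∑ w d * u ^ d) ^ N`, divided by `N`. -/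
theorem natCast_mul_sum_lukasiewiczWords {R : Type*} [CommRing R] [IsDomain R] [CharZero R]
    (w : ℕ → R) (N : ℕ) :
    ((N + 1 : ℕ) : R) * ∑ l ∈ lukasiewiczWords 1 (N + 1), (l.map w).prod =
      PowerSeries.coeff N (PowerSeries.mk w ^ (N + 1)) := by
  rw [PowerSeries.lagrange_of_recurrence (PowerSeries.mk w)
    (fun r N => ∑ l ∈ lukasiewiczWords r N, (l.map w).prod) (by simp [lukasiewiczWords])
    (fun N => by simp [lukasiewiczWords]) (fun r => by simp [lukasiewiczWords])
    (fun r N => by simpa using sum_lukasiewiczWords_succ w r N) 1 (N + 1)]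
  rw [pow_one, PowerSeries.coeff_succ_X_mul]
  simp

/-- The part of `(A + y * B) ^ N` of degree `k` in `y`. -/
theorem PowerSeries.coeff_coeff_map_C_add_pow {R : Type*} [CommRing R] (A B : PowerSeries R)
    (N k m : ℕ) :
    (coeff m ((map Polynomial.C A + C Polynomial.X * map Polynomial.C B) ^ N)).coeff k =
      (N.choose k : R) * coeff m (A ^ (N - k) * B ^ k) := by
  rw [add_comm, add_pow, map_sum, Polynomial.finsetSum_coeff]
  have e : ∀ i, (coeff m ((C Polynomial.X * map Polynomial.C B) ^ i *
      map Polynomial.C A ^ (N - i) * (N.choose i : PowerSeries (Polynomial R)))).coeff k =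
      if i = k then (N.choose k : R) * coeff m (A ^ (N - k) * B ^ k) else 0 := by
    intro i
    have : (C Polynomial.X * map Polynomial.C B) ^ i *
        map Polynomial.C A ^ (N - i) * (N.choose i : PowerSeries (Polynomial R)) =
        C (Polynomial.X ^ i) * map Polynomial.C ((N.choose i : PowerSeries R) *
          (A ^ (N - i) * B ^ i)) := by
      simp only [map_mul, map_pow, map_natCast]; ring
    rw [this, coeff_C_mul, coeff_map, Polynomial.coeff_X_pow_mul', ← nsmul_eq_mul, map_nsmul,
      nsmul_eq_mul]
    split_ifs with h1 h2 h2
    · subst h2; simp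
    · rw [Polynomial.coeff_C, if_neg (by lia)]
    · lia
    · rfl
  simp only [e]
  rw [Finset.sum_ite_eq']
  split_ifs with h
  · rfl
  · rw [Nat.choose_eq_zero_of_lt (by simpa using h)]; simp

/-! ### Ordered trees as Łukasiewicz words -/

namespace OrderedTree

theorem outdegrees_node (ts : List OrderedTree) :
    (node ts).outdegrees = ts.length :: ts.flatMap outdegrees := by
  rw [outdegrees]

/-- Induction on the word, not on the trees: deleting the first letter deletes the first root, whose
children `cs` then join the forest as `cs ++ ts`. The next two lemmas use the same step. -/
theorem isLukasiewicz_flatMap_outdegrees (ts : List OrderedTree) :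
    IsLukasiewicz ts.length (ts.flatMap outdegrees) := by
  generalize hl : ts.flatMap outdegrees = l
  induction l generalizing ts with
  | nil =>
    rcases ts with _ | ⟨⟨cs⟩, ts⟩
    · simp
    · simp [outdegrees_node] at hl
  | cons d l ih =>
    rcases ts with _ | ⟨⟨cs⟩, ts⟩
    · simp at hl
    · simp only [List.flatMap_cons, outdegrees_node, List.cons_append, List.cons.injEq] at hl
      have := ih (cs ++ ts) (by simp [hl.2])
      rw [List.length_append] at this
      rwa [List.length_cons, isLukasiewicz_succ_cons, ← hl.1, add_comm]

theorem eq_of_flatMap_outdegrees_eq {ts ts' : List OrderedTree} (hlen : ts.length = ts'.length)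
    (h : ts.flatMap outdegrees = ts'.flatMap outdegrees) : ts = ts' := by
  generalize hl : ts'.flatMap outdegrees = l at h
  induction l generalizing ts ts' with
  | nil =>
    rcases ts with _ | ⟨⟨cs⟩, ts⟩
    · simpa using hlen.symm
    · simp [outdegrees_node] at h
  | cons d l ih =>
    rcases ts with _ | ⟨⟨cs⟩, ts⟩
    · simp at h
    rcases ts' with _ | ⟨⟨cs'⟩, ts'⟩
    · simp at hl
    simp only [List.flatMap_cons, outdegrees_node, List.cons_append, List.cons.injEq] at hl h
    have hcs : cs.length = cs'.length := by rw [h.1, hl.1]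
    obtain ⟨rfl, rfl⟩ := List.append_inj
      (ih (ts := cs ++ ts) (ts' := cs' ++ ts') (by simp at hlen ⊢; lia) (by simp [hl.2])
        (by simp [h.2])) hcs
    rfl

theorem exists_flatMap_outdegrees_eq {r : ℕ} {l : List ℕ} (h : IsLukasiewicz r l) :
    ∃ ts : List OrderedTree, ts.length = r ∧ ts.flatMap outdegrees = l := by
  induction l generalizing r with
  | nil => exact ⟨[], by simpa using h.symm, rfl⟩
  | cons d l ih =>
    rcases r with _ | r
    · simp at h
    obtain ⟨ts, hts, hl⟩ := ih (isLukasiewicz_succ_cons.1 h)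
    refine ⟨node (ts.take d) :: ts.drop d, by simp [hts], ?_⟩
    rw [List.flatMap_cons, outdegrees_node, List.cons_append, ← List.flatMap_append,
      List.take_append_drop, hl, List.length_take, hts, min_eq_left (by lia)]

theorem outdegrees_injective : Function.Injective outdegrees := by
  intro t t' h
  have := eq_of_flatMap_outdegrees_eq (ts := [t]) (ts' := [t']) rfl (by simpa using h)
  simpa using this

theorem range_outdegrees : Set.range outdegrees = {l | IsLukasiewicz 1 l} := by
  ext l
  constructor
  · rintro ⟨t, rfl⟩
    simpa using isLukasiewicz_flatMap_outdegrees [t]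
  · intro h
    obtain ⟨ts, hts, hl⟩ := exists_flatMap_outdegrees_eq h
    obtain ⟨t, rfl⟩ := List.length_eq_one_iff.1 hts
    exact ⟨t, by simpa using hl⟩

end OrderedTree

theorem List.countP_zero_or_one (l : List ℕ) :
    l.countP (fun d => d = 0 ∨ d = 1) = l.count 0 + l.count 1 := by
  induction l with
  | nil => simp
  | cons d l ih =>
    simp only [countP_cons, count_cons, ih]
    rcases d with _ | _ | d <;> simp <;> lia

/-- Each letter contributes at least `2` to the right side. With `add_sum_eq_length` this bounds the
number of nodes by the numbers of leaves and unary nodes, whence finiteness. -/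
theorem List.two_mul_length_le_sum_add (l : List ℕ) :
    2 * l.length ≤ l.sum + 2 * l.count 0 + l.count 1 := by
  induction l with
  | nil => simp
  | cons d l ih =>
    simp only [length_cons, sum_cons, count_cons]
    rcases d with _ | _ | d <;> simp <;> lia

theorem List.count_zero_add_count_one_le_length (l : List ℕ) :
    l.count 0 + l.count 1 ≤ l.length := by
  rw [← countP_zero_or_one]
  exact countP_le_length

namespace OrderedTree

open Finset

theorem image_outdegrees_eq (n u : ℕ) :
    outdegrees '' {t ∈ withGenerators n | t.numUnary = u} =
      ((range (n + 1 - u)).biUnion fun j => (lukasiewiczWords 1 (n + j)).filter fun l =>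
        l.count 0 = n - u ∧ l.count 1 = u : Finset (List ℕ)) := by
  ext l
  simp only [Set.mem_image, coe_biUnion, Set.mem_iUnion, mem_coe, mem_filter, mem_range,
    mem_lukasiewiczWords, exists_prop]
  constructor
  · rintro ⟨t, ⟨h1, h2⟩, rfl⟩
    have hL : IsLukasiewicz 1 t.outdegrees := by
      simpa using isLukasiewicz_flatMap_outdegrees [t]
    have h3 := hL.add_sum_eq_length
    have h4 := t.outdegrees.two_mul_length_le_sum_add
    have h5 := t.outdegrees.count_zero_add_count_one_le_length
    simp only [withGenerators, Set.mem_ofPred_eq, numGenerators, List.countP_zero_or_one] at h1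
    rw [numUnary] at h2
    exact ⟨t.outdegrees.length - n, by lia, ⟨hL, by lia⟩, by lia, h2⟩
  · rintro ⟨j, hj, ⟨hL, hlen⟩, h0, h1⟩
    obtain ⟨t, rfl⟩ : l ∈ Set.range outdegrees := by rw [range_outdegrees]; exact hL
    refine ⟨t, ⟨?_, h1⟩, rfl⟩
    simp only [withGenerators, Set.mem_ofPred_eq, numGenerators, List.countP_zero_or_one]
    lia

theorem finite_withGenerators_numUnary (n u : ℕ) :
    {t ∈ withGenerators n | t.numUnary = u}.Finite := by
  rw [← Set.finite_image_iff outdegrees_injective.injOn, image_outdegrees_eq]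
  exact finite_toSet _

theorem ncard_withGenerators_numUnary (n u : ℕ) :
    {t ∈ withGenerators n | t.numUnary = u}.ncard =
      ∑ j ∈ range (n + 1 - u), #{l ∈ lukasiewiczWords 1 (n + j) | l.count 0 = n - u ∧
        l.count 1 = u} := by
  rw [← Set.ncard_image_of_injective _ outdegrees_injective, image_outdegrees_eq,
    Set.ncard_coe_finset, card_biUnion]
  intro i _ j _ hij
  simp only [disjoint_left, mem_filter, mem_lukasiewiczWords]
  lia

theorem numUnary_lt_numGenerators (t : OrderedTree) : t.numUnary < t.numGenerators := by
  have hL : IsLukasiewicz 1 t.outdegrees := by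
    simpa using isLukasiewicz_flatMap_outdegrees [t]
  have hne : t.outdegrees ≠ [] := by
    rcases t with ⟨ts⟩
    simp [outdegrees_node]
  have h0 := hL.getLast_eq_zero hne
  have := List.count_pos_iff.2 (h0 ▸ List.getLast_mem hne)
  rw [numUnary, numGenerators, List.countP_zero_or_one]
  lia

theorem finite_withGenerators (n : ℕ) : (withGenerators n).Finite := by
  refine ((range n).finite_toSet.biUnion fun u _ => finite_withGenerators_numUnary n u).subset
    fun t ht => Set.mem_biUnion (x := t.numUnary) ?_ ⟨ht, rfl⟩
  have := t.numUnary_lt_numGenerators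
  rw [show t.numGenerators = n from ht] at this
  simpa using this

theorem ncard_withGenerators (n : ℕ) :
    (withGenerators n).ncard =
      ∑ u ∈ range n, {t ∈ withGenerators n | t.numUnary = u}.ncard := by
  classical
  have hfin := finite_withGenerators n
  rw [Set.ncard_eq_toFinset_card _ hfin,
    card_eq_sum_card_fiberwise (f := numUnary) (t := range n)]
  · refine sum_congr rfl fun u _ => ?_
    rw [← Set.ncard_coe_finset]
    congr 1
    ext t
    simp
  · intro t ht
    have := t.numUnary_lt_numGenerators
    rw [show t.numGenerators = n from hfin.mem_toFinset.1 ht] at this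
    simpa using this

end OrderedTree

/-! ### Counting trees by generators and unary nodes -/

/-- The number of words of length `N + 1` with given numbers of letters `0` and `1`. -/
theorem natCast_mul_card_lukasiewiczWords_count (N a b : ℕ) :
    ((N + 1 : ℕ) : ℚ) *
        Finset.card {l ∈ lukasiewiczWords 1 (N + 1) | l.count 0 = a ∧ l.count 1 = b} =
      (N + 1).choose a * (N + 1 - a).choose b *
        PowerSeries.coeff N ((PowerSeries.X ^ 2 * PowerSeries.mk 1) ^ (N + 1 - a - b) *
          PowerSeries.X ^ b : PowerSeries ℚ) := by
  -- The outer variable marks leaves, the inner one unary nodes; branching nodes contribute `u² + u³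
  -- + ⋯`.
  let w : ℕ → Polynomial (Polynomial ℚ) := fun d =>
    if d = 0 then Polynomial.X else if d = 1 then Polynomial.C Polynomial.X else 1
  have hw (l : List ℕ) : (l.map w).prod =
      Polynomial.C (Polynomial.X ^ l.count 1) * Polynomial.X ^ l.count 0 := by
    induction l with
    | nil => simp
    | cons d l ih =>
      rw [List.map_cons, List.prod_cons, ih]
      rcases d with _ | _ | d <;> simp [w] <;> ring
  have hmk : PowerSeries.mk w =
      PowerSeries.map Polynomial.C
        (PowerSeries.map Polynomial.C (PowerSeries.X ^ 2 * PowerSeries.mk 1) +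
          PowerSeries.C Polynomial.X * PowerSeries.map Polynomial.C PowerSeries.X) +
      PowerSeries.C Polynomial.X * PowerSeries.map Polynomial.C 1 := by
    ext1 d
    rcases d with _ | _ | d
    · simp [w]
    · simp [w, PowerSeries.coeff_X_pow_mul']
    · simp [w, PowerSeries.coeff_X_pow_mul']
  have key := natCast_mul_sum_lukasiewiczWords w N
  rw [hmk] at key
  have key2 := congrArg (fun p => (Polynomial.coeff (Polynomial.coeff p a) b)) key
  simp only [PowerSeries.coeff_coeff_map_C_add_pow, one_pow, mul_one, ← nsmul_eq_mul,
    Polynomial.coeff_smul] at key2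
  simp only [hw, Polynomial.finsetSum_coeff, Polynomial.coeff_C_mul_X_pow] at key2
  rw [Finset.card_filter]
  push_cast
  simp only [nsmul_eq_mul] at key2
  rw [mul_assoc, ← key2]
  congr 1
  · push_cast; ring
  refine Finset.sum_congr rfl fun l _ => ?_
  simp only [eq_comm (a := l.count 0), eq_comm (a := l.count 1)]
  by_cases h0 : a = l.count 0 <;> by_cases h1 : b = l.count 1 <;>
    simp [h0, h1, Polynomial.coeff_X_pow]

theorem PowerSeries.coeff_mk_one_pow_succ {R : Type*} [CommRing R] (d m : ℕ) :
    coeff m ((mk 1 : PowerSeries R) ^ (d + 1)) = (d + m).choose d := by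
  rw [mk_one_pow_eq_mk_choose_add, coeff_mk]

theorem PowerSeries.coeff_X_mul_mk_one_pow {R : Type*} [CommRing R] (j m : ℕ) :
    coeff (m + 1) ((X * mk 1 : PowerSeries R) ^ (j + 1)) = m.choose j := by
  rw [mul_pow, coeff_X_pow_mul']
  split_ifs with h
  · rw [coeff_mk_one_pow_succ]
    congr 2
    lia
  · rw [Nat.choose_eq_zero_of_lt (by lia), Nat.cast_zero]

/-- Placing the leaves and then the unary nodes amounts to placing the `n` generators and then
choosing the unary ones among them; the factor `j + 1` is absorbed into `binom(n+j+1, j+1)`. -/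
theorem Nat.choose_mul_choose_mul_eq {n u j : ℕ} (hu : u ≤ n) :
    (n + (j + 1)).choose (n - u) * (u + (j + 1)).choose u * (j + 1) =
      (n + (j + 1)) * (n.choose u * (n + j).choose j) := by
  have h1 := Nat.choose_mul (n := n + (j + 1)) (k := n) (s := n - u) (by lia)
  rw [show n + (j + 1) - (n - u) = u + (j + 1) by lia, show n - (n - u) = u by lia,
    Nat.choose_symm hu] at h1
  have h2 := Nat.add_one_mul_choose_eq (n + j) j
  have h3 : (n + (j + 1)).choose n = (n + j + 1).choose (j + 1) := by
    rw [← Nat.choose_symm (by lia)]; congr 1; lia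
  rw [← h1, h3, mul_right_comm, ← h2]
  ring

open Finset in
theorem card_lukasiewiczWords_count {n u : ℕ} (hu : u + 2 ≤ n) (j : ℕ) :
    (#{l ∈ lukasiewiczWords 1 (n + (j + 1)) | l.count 0 = n - u ∧ l.count 1 = u} : ℚ) =
      n.choose u * (1 / ((j + 1 : ℕ) : ℚ) * (n - u - 2).choose j * (n + j).choose j) := by
  have h1 := natCast_mul_card_lukasiewiczWords_count (n + j) (n - u) u
  -- After removing `X ^ (u + j + 1)` the coefficient counts compositions of `n - u - 1` into `j +
  -- 1` parts.
  rw [show n + j + 1 - (n - u) - u = j + 1 by lia, show n + j + 1 - (n - u) = u + (j + 1) by lia,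
    show (PowerSeries.X ^ 2 * PowerSeries.mk 1) ^ (j + 1) * PowerSeries.X ^ u =
      PowerSeries.X ^ (u + (j + 1)) * (PowerSeries.X * PowerSeries.mk 1 : PowerSeries ℚ) ^ (j + 1) by
      ring, show n + j = n - u - 2 + 1 + (u + (j + 1)) by lia, PowerSeries.coeff_X_pow_mul,
    PowerSeries.coeff_X_mul_mk_one_pow, show n - u - 2 + 1 + (u + (j + 1)) = n + j by lia] at h1
  have h2 := Nat.choose_mul_choose_mul_eq (n := n) (u := u) (j := j) (by lia)
  have h3 : ((n + (j + 1)).choose (n - u) : ℚ) * (u + (j + 1)).choose u * (j + 1 : ℕ) =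
      (n + j + 1 : ℕ) * (n.choose u * (n + j).choose j) := by exact_mod_cast h2
  have h4 : ((n + j + 1 : ℕ) : ℚ) ≠ 0 := by positivity
  have h5 : ((j + 1 : ℕ) : ℚ) ≠ 0 := by positivity
  apply mul_left_cancel₀ h4
  apply mul_left_cancel₀ h5
  rw [← add_assoc, h1]
  rw [← add_assoc] at h3
  field_simp
  linear_combination ((n - u - 2).choose j : ℚ) * h3

namespace OrderedTree

open Finset

/-- Without branching nodes a tree is a path, which has exactly one leaf. -/
theorem card_lukasiewiczWords_count_self {n u : ℕ} (hu : u < n) :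
    (#{l ∈ lukasiewiczWords 1 n | l.count 0 = n - u ∧ l.count 1 = u} : ℚ) =
      if u + 1 = n then 1 else 0 := by
  obtain ⟨m, rfl⟩ : ∃ m, n = m + 1 := ⟨n - 1, by lia⟩
  have h1 := natCast_mul_card_lukasiewiczWords_count m (m + 1 - u) u
  have h2 : ((m + 1 : ℕ) : ℚ) ≠ 0 := by positivity
  apply mul_left_cancel₀ h2
  rw [h1, show m + 1 - (m + 1 - u) = u by lia, show u - u = 0 by lia, pow_zero, one_mul,
    PowerSeries.coeff_X_pow]
  by_cases h : m = u
  · subst h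
    simp
  · rw [if_neg h, if_neg (by lia)]
    simp

theorem ncard_withGenerators_numUnary_eq_sum {n k : ℕ} (hk : 1 ≤ k) (hkn : k < n) :
    ({t ∈ withGenerators n | t.numUnary = k - 1}.ncard : ℚ) =
      n.choose (k - 1) * ∑ j ∈ Icc 1 (n - k),
        (1 / (j : ℚ)) * (n - k - 1).choose (j - 1) * (n + j - 1).choose (j - 1) := by
  obtain ⟨u, rfl⟩ : ∃ u, k = u + 1 := ⟨k - 1, by lia⟩
  rw [add_tsub_cancel_right, ncard_withGenerators_numUnary,
    show n + 1 - u = n - u - 1 + 1 + 1 by lia, sum_range_succ']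
  push_cast
  rw [add_zero, card_lukasiewiczWords_count_self (by lia), if_neg (by lia), add_zero,
    sum_range_succ]
  simp only [card_lukasiewiczWords_count (show u + 2 ≤ n by lia)]
  -- The top index of the range contributes nothing: `n - u` leaves allow at most `n - u - 1`
  -- branching nodes.
  rw [Nat.choose_eq_zero_of_lt (show n - u - 2 < n - u - 1 by lia), ← mul_sum]
  simp only [Nat.cast_zero, mul_zero, zero_mul, add_zero]
  congr 1
  refine sum_bij' (fun j _ => j + 1) (fun j _ => j - 1) ?_ ?_ ?_ ?_ ?_ <;>
    simp only [mem_range, mem_Icc] <;> intro j hj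
  · lia
  · lia
  · lia
  · lia
  · rw [show n - (u + 1) - 1 = n - u - 2 by lia, add_tsub_cancel_right,
      show n + (j + 1) - 1 = n + j by lia]

theorem ncard_withGenerators_numUnary_pred {n : ℕ} (hn : 1 ≤ n) :
    ({t ∈ withGenerators n | t.numUnary = n - 1}.ncard : ℚ) = 1 := by
  rw [ncard_withGenerators_numUnary, show n + 1 - (n - 1) = 1 + 1 by lia, sum_range_succ,
    sum_range_one]
  push_cast
  rw [add_zero, card_lukasiewiczWords_count_self (by lia), if_pos (by lia)]
  -- The term `j = 1` vanishes: a branching node needs two leaves, and only one is available.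
  have h1 := natCast_mul_card_lukasiewiczWords_count n (n - (n - 1)) (n - 1)
  rw [show PowerSeries.coeff n _ = (0 : ℚ) from ?_, mul_zero] at h1
  · have h2 : ((n + 1 : ℕ) : ℚ) ≠ 0 := by positivity
    rw [(mul_eq_zero.1 h1).resolve_left h2, add_zero]
  · rw [show n + 1 - (n - (n - 1)) - (n - 1) = 1 by lia, pow_one, mul_right_comm, ← pow_add,
      PowerSeries.coeff_X_pow_mul', if_neg (by lia)]

end OrderedTree

/-! ### Dyck paths as Łukasiewicz words -/

/-- The numbers of up-steps between consecutive down-steps of a path. -/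
def dyckRuns (s : List DyckStep) : List ℕ :=
  (s.splitOn DyckStep.D).map List.length

section

open DyckStep

@[simp] theorem dyckRuns_nil : dyckRuns [] = [0] := by simp [dyckRuns]

@[simp] theorem dyckRuns_D_cons (s : List DyckStep) : dyckRuns (D :: s) = 0 :: dyckRuns s := by
  simp [dyckRuns, List.splitOn_cons_eq_if_modifyHead]

@[simp] theorem dyckRuns_ne_nil (s : List DyckStep) : dyckRuns s ≠ [] := by
  simp [dyckRuns]

theorem dyckRuns_U_cons {s : List DyckStep} {d : ℕ} {l : List ℕ} (h : dyckRuns s = d :: l) :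
    dyckRuns (U :: s) = (d + 1) :: l := by
  rw [dyckRuns] at h ⊢
  rw [List.splitOn_cons_eq_if_modifyHead, if_neg (by decide)]
  cases hs : s.splitOn D with
  | nil => simp at hs
  | cons a b =>
    rw [hs] at h
    simpa using h

theorem length_dyckRuns (s : List DyckStep) : (dyckRuns s).length = s.count D + 1 := by
  induction s with
  | nil => simp
  | cons x s ih =>
    cases x
    · obtain ⟨d, l, h⟩ := List.exists_cons_of_ne_nil (dyckRuns_ne_nil s)
      rw [dyckRuns_U_cons h, List.length_cons, List.count_cons_of_ne (by decide), ← ih, h,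
        List.length_cons]
    · simp [ih]

/-- The pieces between down-steps contain only up-steps, so their lengths determine the path. -/
theorem map_replicate_dyckRuns (s : List DyckStep) :
    (dyckRuns s).map (List.replicate · U) = s.splitOn D := by
  induction s with
  | nil => simp
  | cons x s ih =>
    cases x
    · obtain ⟨d, l, h⟩ := List.exists_cons_of_ne_nil (dyckRuns_ne_nil s)
      rw [dyckRuns_U_cons h, List.splitOn_cons_eq_if_modifyHead, if_neg (by decide), ← ih, h]
      simp [List.replicate_succ]
    · rw [dyckRuns_D_cons, List.splitOn_cons_eq_if_modifyHead, if_pos (by decide), List.map_cons,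
        ih, List.replicate_zero]

theorem dyckRuns_injective : Function.Injective dyckRuns := by
  intro s t h
  have := congrArg (fun l => [D].intercalate (l.map (List.replicate · U))) h
  simpa only [map_replicate_dyckRuns, List.intercalate_splitOn] using this

theorem exists_dyckRuns_eq {l : List ℕ} (hl : l ≠ []) : ∃ s, dyckRuns s = l := by
  refine ⟨[D].intercalate (l.map (List.replicate · U)), ?_⟩
  rw [dyckRuns, List.splitOn_intercalate]
  · simp [Function.comp_def]
  · simp [List.mem_replicate]
  · simpa using hl

/-- The number of pending trees is the height plus one: an up-step adds one, a down-step completes a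
letter and uses one up. The extra one is used by the final run, which no down-step follows. -/
theorem isLukasiewicz_dyckRuns {h : ℕ} {s : List DyckStep} :
    IsLukasiewicz (h + 1) (dyckRuns s) ↔
      h + s.count U = s.count D ∧ ∀ i, (s.take i).count D ≤ h + (s.take i).count U := by
  induction s generalizing h with
  | nil => simp
  | cons x s ih =>
    cases x
    · obtain ⟨d, l, hd⟩ := List.exists_cons_of_ne_nil (dyckRuns_ne_nil s)
      have := ih (h := h + 1)
      rw [hd, isLukasiewicz_succ_cons] at this
      rw [dyckRuns_U_cons hd, isLukasiewicz_succ_cons, ← add_assoc, add_right_comm, this]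
      refine and_congr (by simp; lia) ⟨fun H i => ?_, fun H i => ?_⟩
      · cases i with
        | zero => simp
        | succ i => have := H i; simp; lia
      · have := H (i + 1)
        simp at this; lia
    · rw [dyckRuns_D_cons, isLukasiewicz_succ_cons, add_zero]
      cases h with
      | zero =>
        refine iff_of_false ?_ fun H => ?_
        · obtain ⟨d, l, hd⟩ := List.exists_cons_of_ne_nil (dyckRuns_ne_nil s)
          simp [hd]
        · simpa using H.2 1
      | succ h =>
        rw [ih]
        refine and_congr (by simp; lia) ⟨fun H i => ?_, fun H i => ?_⟩
        · cases i with
          | zero => simp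
          | succ i => have := H i; simp; lia
        · have := H (i + 1)
          simp at this; lia

theorem DyckWord.isLukasiewicz_dyckRuns (p : DyckWord) :
    IsLukasiewicz 1 (dyckRuns p.toList) :=
  _root_.isLukasiewicz_dyckRuns.2
    ⟨by simpa using p.count_U_eq_count_D, by simpa using p.count_D_le_count_U⟩

theorem DyckWord.dyckRuns_mem_lukasiewiczWords {p : DyckWord} {n : ℕ} (hp : p.semilength = n) :
    dyckRuns p.toList ∈ lukasiewiczWords 1 (n + 1) := by
  rw [mem_lukasiewiczWords, length_dyckRuns, ← hp, p.semilength_eq_count_D]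
  exact ⟨p.isLukasiewicz_dyckRuns, rfl⟩

theorem exists_dyckWord_dyckRuns_eq {n : ℕ} {l : List ℕ} (hl : l ∈ lukasiewiczWords 1 (n + 1)) :
    ∃ p : DyckWord, p.semilength = n ∧ dyckRuns p.toList = l := by
  rw [mem_lukasiewiczWords] at hl
  obtain ⟨s, rfl⟩ := exists_dyckRuns_eq (l := l) (by rintro rfl; simp at hl)
  obtain ⟨h1, h2⟩ := isLukasiewicz_dyckRuns.1 hl.1
  refine ⟨⟨s, by simpa using h1, by simpa using h2⟩, ?_, rfl⟩
  have := hl.2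
  rw [length_dyckRuns] at this
  rw [DyckWord.semilength]
  lia

theorem DyckWord.toList_injective : Function.Injective DyckWord.toList :=
  fun _ _ h => DyckWord.ext h

theorem DyckWord.finite_semilength_eq (n : ℕ) : {p : DyckWord | p.semilength = n}.Finite :=
  Set.Finite.of_injOn (f := fun p => dyckRuns p.toList) (t := lukasiewiczWords 1 (n + 1))
    (fun _ hp => dyckRuns_mem_lukasiewiczWords hp)
    (dyckRuns_injective.comp toList_injective).injOn (Finset.finite_toSet _)

theorem dyckAscents_eq (p : DyckWord) :
    dyckAscents p = (dyckRuns p.toList).filter fun j => 0 < j := rfl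

/-- Every nonempty run except the last ends in a peak. The path is arbitrary here so that the
induction can pass to suffixes. -/
theorem count_zip_tail_eq (s : List DyckStep) :
    (s.zip s.tail).count (U, D) = ((dyckRuns s).dropLast.filter fun j => 0 < j).length := by
  induction s with
  | nil => simp
  | cons x s ih =>
    obtain ⟨d, l, hd⟩ := List.exists_cons_of_ne_nil (dyckRuns_ne_nil s)
    cases x
    · rw [dyckRuns_U_cons hd]
      cases s with
      | nil => simp at hd ⊢; simp [hd.2]
      | cons y s =>
        cases y
        · obtain ⟨e, m, he⟩ := List.exists_cons_of_ne_nil (dyckRuns_ne_nil s)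
          have h2 := dyckRuns_U_cons he
          rw [h2] at hd ih
          simp only [List.cons.injEq] at hd
          obtain ⟨rfl, rfl⟩ := hd
          rw [List.tail_cons] at ih ⊢
          rw [List.zip_cons_cons, List.count_cons_of_ne (by decide), ih]
          cases m <;> simp
        · rw [dyckRuns_D_cons, List.cons.injEq] at hd
          obtain ⟨rfl, rfl⟩ := hd
          simp only [List.tail_cons] at ih
          rw [List.tail_cons, List.zip_cons_cons, List.count_cons_self, ih]
          simp [List.dropLast_cons_of_ne_nil]
    · rw [dyckRuns_D_cons, List.dropLast_cons_of_ne_nil (dyckRuns_ne_nil s)]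
      cases s with
      | nil => simp
      | cons y s =>
        rw [List.tail_cons, List.zip_cons_cons, List.count_cons_of_ne (by simp)]
        simpa using ih

theorem dyckPeaks_eq_length_dyckAscents (p : DyckWord) :
    dyckPeaks p = (dyckAscents p).length := by
  have h1 := List.dropLast_append_getLast (dyckRuns_ne_nil p.toList)
  rw [p.isLukasiewicz_dyckRuns.getLast_eq_zero (dyckRuns_ne_nil _)] at h1
  rw [dyckPeaks, count_zip_tail_eq, dyckAscents_eq]
  conv_rhs => rw [← h1]
  simp

/-! ### Counting colored Dyck paths by peaks -/

namespace ColoredDyckPath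

/-- A colored Dyck path is a Dyck path together with a color for each of its ascents. -/
def equivSigma (c : ℕ → ℕ) : ColoredDyckPath c ≃
    Σ p : DyckWord, (i : Fin (dyckAscents p).length) → Fin (c ((dyckAscents p).get i)) where
  toFun P := ⟨P.path, P.color⟩
  invFun P := ⟨P.1, P.2⟩

theorem setOf_path_mem_eq_image (c : ℕ → ℕ) (S : Finset DyckWord) :
    {P : ColoredDyckPath c | P.path ∈ S} = (equivSigma c).symm ''
      (S.sigma fun p => (Finset.univ :
        Finset ((i : Fin (dyckAscents p).length) → Fin (c ((dyckAscents p).get i))))) := by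
  ext P
  rw [Equiv.image_symm_eq_preimage]
  simp [equivSigma]

theorem finite_setOf_path_mem (c : ℕ → ℕ) (S : Finset DyckWord) :
    {P : ColoredDyckPath c | P.path ∈ S}.Finite := by
  rw [setOf_path_mem_eq_image]
  exact (Finset.finite_toSet _).image _

theorem ncard_setOf_path_mem (c : ℕ → ℕ) (S : Finset DyckWord) :
    {P : ColoredDyckPath c | P.path ∈ S}.ncard = ∑ p ∈ S, ((dyckAscents p).map c).prod := by
  rw [setOf_path_mem_eq_image, Set.ncard_image_of_injective _ (Equiv.injective _),
    Set.ncard_coe_finset, Finset.card_sigma]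
  refine Finset.sum_congr rfl fun p _ => ?_
  rw [Finset.card_univ, Fintype.card_pi]
  simp only [Fintype.card_fin, List.get_eq_getElem]
  exact Fin.prod_univ_fun_getElem _ c

theorem finite_semilength_eq (c : ℕ → ℕ) (n : ℕ) :
    {P : ColoredDyckPath c | P.path.semilength = n}.Finite := by
  have := finite_setOf_path_mem c (DyckWord.finite_semilength_eq n).toFinset
  simpa using this

theorem ncard_semilength_peaks (c : ℕ → ℕ) (n k : ℕ) :
    {P : ColoredDyckPath c | P.path.semilength = n ∧ dyckPeaks P.path = k}.ncard =
      ∑ l ∈ lukasiewiczWords 1 (n + 1) with (l.filter fun j => 0 < j).length = k,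
        ((l.filter fun j => 0 < j).map c).prod := by
  have hfin : {p : DyckWord | p.semilength = n ∧ dyckPeaks p = k}.Finite :=
    (DyckWord.finite_semilength_eq n).subset fun p hp => hp.1
  have h1 := ncard_setOf_path_mem c hfin.toFinset
  simp only [Set.Finite.mem_toFinset, Set.mem_ofPred_eq] at h1
  rw [h1]
  refine Finset.sum_bij (fun p _ => dyckRuns p.toList) ?_ ?_ ?_ ?_
  · intro p hp
    rw [Set.Finite.mem_toFinset] at hp
    rw [Finset.mem_filter, ← dyckAscents_eq, ← dyckPeaks_eq_length_dyckAscents]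
    exact ⟨DyckWord.dyckRuns_mem_lukasiewiczWords hp.1, hp.2⟩
  · intro p _ q _ h
    exact DyckWord.toList_injective (dyckRuns_injective h)
  · intro l hl
    rw [Finset.mem_filter] at hl
    obtain ⟨p, hp, rfl⟩ := exists_dyckWord_dyckRuns_eq hl.1
    refine ⟨p, ?_, rfl⟩
    rw [Set.Finite.mem_toFinset]
    exact ⟨hp, by rw [dyckPeaks_eq_length_dyckAscents]; exact hl.2⟩
  · intro p _
    rfl

theorem natCast_mul_ncard_semilength_peaks (c : ℕ → ℕ) (n k : ℕ) :
    ((n + 1 : ℕ) : ℚ) *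
        {P : ColoredDyckPath c | P.path.semilength = n ∧ dyckPeaks P.path = k}.ncard =
      (n + 1).choose k *
        PowerSeries.coeff n ((PowerSeries.X * PowerSeries.mk fun j => (c (j + 1) : ℚ)) ^ k) := by
  -- The polynomial variable marks positive letters, that is, ascents, which are as many as the
  -- peaks.
  let w : ℕ → Polynomial ℚ := fun d =>
    if d = 0 then 1 else Polynomial.C (c d : ℚ) * Polynomial.X
  have hw (l : List ℕ) : (l.map w).prod =
      Polynomial.C (((l.filter fun j => 0 < j).map c).prod : ℚ) *
        Polynomial.X ^ (l.filter fun j => 0 < j).length := by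
    induction l with
    | nil => simp
    | cons d l ih =>
      rw [List.map_cons, List.prod_cons, ih]
      rcases d with _ | d
      · simp [w]
      · simp [w]; ring
  have hmk : PowerSeries.mk w = PowerSeries.map Polynomial.C 1 +
      PowerSeries.C Polynomial.X * PowerSeries.map Polynomial.C
        (PowerSeries.X * PowerSeries.mk fun j => (c (j + 1) : ℚ)) := by
    ext1 d
    rcases d with _ | d
    · simp [w]
    · rw [map_add, PowerSeries.coeff_C_mul, PowerSeries.coeff_map, PowerSeries.coeff_map,
        PowerSeries.coeff_succ_X_mul]
      simp [w, PowerSeries.coeff_one, mul_comm]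
  have key := natCast_mul_sum_lukasiewiczWords w n
  rw [hmk] at key
  have key2 := congrArg (fun p => Polynomial.coeff p k) key
  simp only [PowerSeries.coeff_coeff_map_C_add_pow, one_pow, one_mul, ← nsmul_eq_mul,
    Polynomial.coeff_smul] at key2
  simp only [hw, Polynomial.finsetSum_coeff, Polynomial.coeff_C_mul_X_pow, nsmul_eq_mul] at key2
  rw [← key2, ncard_semilength_peaks, Finset.sum_filter]
  push_cast
  simp only [eq_comm (a := k)]

end ColoredDyckPath

end

/-! ### The little Schröder series and the coefficients of its powers -/

/-- The generating function of the little Schröder numbers. -/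
noncomputable def littleSchroderSeries : PowerSeries ℚ :=
  PowerSeries.mk fun n => (littleSchroder n : ℚ)

theorem littleSchroder_zero : littleSchroder 0 = 1 := by simp [littleSchroder]

theorem two_mul_littleSchroderSeries :
    2 * littleSchroderSeries =
      1 + PowerSeries.map (Nat.castRingHom ℚ) PowerSeries.largeSchroderSeries := by
  ext n
  rw [two_mul, map_add, map_add, ← two_mul, PowerSeries.coeff_map, PowerSeries.coeff_one,
    littleSchroderSeries, PowerSeries.coeff_mk, PowerSeries.coeff_largeSchroderSeries]
  rcases eq_or_ne n 0 with rfl | hn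
  · simp [littleSchroder_zero]; norm_num
  · rw [if_neg hn, zero_add, ← Nat.two_mul_smallSchroder_succ hn, littleSchroder]
    simp

open PowerSeries in
theorem littleSchroderSeries_functional_equation :
    littleSchroderSeries * (1 - 2 * (X * littleSchroderSeries)) =
      1 - X * littleSchroderSeries := by
  have h1 := two_mul_littleSchroderSeries
  have h2 := congrArg (map (Nat.castRingHom ℚ))
    largeSchroderSeries_eq_one_add_X_mul_largeSchroderSeries_add_X_mul_largeSchroderSeries_sq
  rw [map_add, map_add, map_mul, map_mul, map_pow, map_X, map_one] at h2
  have h3 : (2 : PowerSeries ℚ) ≠ 0 := by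
    intro h
    simpa [map_ofNat] using congrArg constantCoeff h
  apply mul_left_cancel₀ h3
  generalize map (Nat.castRingHom ℚ) largeSchroderSeries = L at h1 h2
  generalize littleSchroderSeries = s at h1 ⊢
  have h4 : L = 2 * s - 1 := by rw [h1]; ring
  subst h4
  linear_combination h2

section

open PowerSeries

/-- The power series `1 / (1 - u / (1 - u))`. -/
noncomputable def compositionSeries : PowerSeries ℚ :=
  (mk 1 : PowerSeries ℚ).subst (X * mk 1 : PowerSeries ℚ)

theorem hasSubst_X_mul_mk_one : HasSubst (X * mk 1 : PowerSeries ℚ) :=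
  HasSubst.of_constantCoeff_zero' (by simp)

theorem mul_compositionSeries : (1 - 2 * X) * compositionSeries = 1 - X := by
  have h1 : (mk 1 : PowerSeries ℚ) * (1 - X) = 1 := mk_one_mul_one_sub_eq_one ℚ
  have h2 := congrArg (subst (X * mk 1 : PowerSeries ℚ)) h1
  rw [← coe_substAlgHom hasSubst_X_mul_mk_one, map_mul, map_sub, map_one,
    coe_substAlgHom hasSubst_X_mul_mk_one, subst_X hasSubst_X_mul_mk_one] at h2
  change compositionSeries * _ = _ at h2
  linear_combination (1 - X) * h2 + X * compositionSeries * h1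

/-- Since `compositionSeries` is `(1 - u) / (1 - 2u)`, this is the functional equation divided by `1
- 2 X s`, in the form required for Lagrange inversion. -/
theorem X_mul_littleSchroderSeries_eq :
    X * littleSchroderSeries = X * compositionSeries.subst (X * littleSchroderSeries) := by
  have hs : HasSubst (X * littleSchroderSeries) := HasSubst.of_constantCoeff_zero' (by simp)
  have h1 := congrArg (subst (X * littleSchroderSeries)) mul_compositionSeries
  rw [← coe_substAlgHom hs, map_mul, map_sub, map_sub, map_mul, map_one, map_ofNat,
    coe_substAlgHom hs, subst_X hs] at h1
  have h2 : (1 - 2 * (X * littleSchroderSeries)) ≠ 0 := by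
    intro h
    simpa using congrArg constantCoeff h
  congr 1
  apply mul_left_cancel₀ h2
  rw [h1, mul_comm, littleSchroderSeries_functional_equation]

-- Expand `1 / (1 - t) ^ (n + 1)` at `t = u / (1 - u)`; the coefficients of the powers of `t` count
-- compositions.
open Finset in
theorem coeff_compositionSeries_pow (n m : ℕ) :
    coeff (m + 1) (compositionSeries ^ (n + 1)) =
      ∑ j ∈ range (m + 1), ((n + (j + 1)).choose n : ℚ) * m.choose j := by
  rw [compositionSeries, ← subst_pow hasSubst_X_mul_mk_one, mk_one_pow_eq_mk_choose_add,
    coeff_subst' hasSubst_X_mul_mk_one,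
    finsum_eq_sum_of_support_subset (s := range (m + 1 + 1)), sum_range_succ']
  · simp [coeff_X_mul_mk_one_pow, coeff_one]
  · intro d hd
    by_contra hlarge
    refine hd ?_
    simp only [coe_range, Set.mem_Iio, not_lt] at hlarge
    simp only [mul_pow, coeff_X_pow_mul']
    rw [if_neg (by lia), smul_zero]

open Finset in
theorem coeff_X_mul_littleSchroderSeries_pow {n k : ℕ} (hk : 1 ≤ k) (hkn : k < n) :
    coeff n ((X * littleSchroderSeries) ^ k) = k * ∑ j ∈ Icc 1 (n - k),
        (1 / (j : ℚ)) * (n - k - 1).choose (j - 1) * (n + j - 1).choose (j - 1) := by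
  have h1 := natCast_mul_coeff_pow_of_eq_X_mul_subst X_mul_littleSchroderSeries_eq k n
  obtain ⟨m, rfl⟩ : ∃ m, n = k + (m + 1) := ⟨n - k - 1, by lia⟩
  rw [coeff_X_pow_mul', if_pos (by lia), show k + (m + 1) - k = m + 1 by lia,
    show k + (m + 1) = k + m + 1 by lia, coeff_compositionSeries_pow] at h1
  have hn : ((k + m + 1 : ℕ) : ℚ) ≠ 0 := by positivity
  apply mul_left_cancel₀ hn
  rw [show k + (m + 1) = k + m + 1 by lia, h1, mul_left_comm, show k + m + 1 - k = m + 1 by lia]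
  congr 1
  rw [mul_sum]
  refine sum_bij' (fun j _ => j + 1) (fun j _ => j - 1) ?_ ?_ ?_ ?_ ?_ <;>
    simp only [mem_range, mem_Icc] <;> intro j hj
  · lia
  · lia
  · lia
  · lia
  · rw [add_tsub_cancel_right, add_tsub_cancel_right,
      show k + m + 1 + (j + 1) - 1 = k + m + (j + 1) by lia]
    -- In terms of `n = k + m + 1` this is `(j+1) * binom(n+j, j+1) = n * binom(n+j, j)`, which
    -- trades the factor `1/n` of Lagrange inversion for `1/(j+1)`.
    have h2 := Nat.choose_succ_right_eq (k + m + (j + 1)) j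
    have h3 : (k + m + (j + 1)).choose (k + m) = (k + m + (j + 1)).choose (j + 1) := by
      rw [← Nat.choose_symm (by lia)]; congr 1; lia
    rw [show k + m + (j + 1) - j = k + m + 1 by lia, ← h3] at h2
    have h4 : ((k + m + (j + 1)).choose (k + m) : ℚ) * (j + 1 : ℕ) =
      (k + m + (j + 1)).choose j * (k + m + 1 : ℕ) := by exact_mod_cast h2
    have h5 : ((j + 1 : ℕ) : ℚ) ≠ 0 := by positivity
    field_simp
    linear_combination (m.choose j : ℚ) * h4

theorem coeff_X_mul_littleSchroderSeries_pow_self (n : ℕ) :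
    coeff n ((X * littleSchroderSeries) ^ n) = 1 := by
  rw [mul_pow, coeff_X_pow_mul', if_pos le_rfl]
  rw [tsub_self, coeff_zero_eq_constantCoeff_apply, map_pow, ← coeff_zero_eq_constantCoeff_apply,
    littleSchroderSeries, coeff_mk, littleSchroder_zero, Nat.cast_one, one_pow]

/-! ### Comparison of trees and paths -/

theorem mul_ncard_schroderDyckPaths_peaks {n k : ℕ} (hk : 1 ≤ k) :
    (k : ℚ) * {P ∈ schroderDyckPaths n | dyckPeaks P.path = k}.ncard =
      n.choose (k - 1) * coeff n ((X * littleSchroderSeries) ^ k) := by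
  have h1 := ColoredDyckPath.natCast_mul_ncard_semilength_peaks
    (fun j => littleSchroder (j - 1)) n k
  change _ * (({P ∈ schroderDyckPaths n | dyckPeaks P.path = k}.ncard : ℕ) : ℚ) =
    _ * coeff n ((X * littleSchroderSeries) ^ k) at h1
  obtain ⟨u, rfl⟩ : ∃ u, k = u + 1 := ⟨k - 1, by lia⟩
  have h2 := Nat.add_one_mul_choose_eq n u
  have h3 : ((n + 1 : ℕ) : ℚ) * n.choose u = (n + 1).choose (u + 1) * (u + 1 : ℕ) := by
    exact_mod_cast h2
  have hn : ((n + 1 : ℕ) : ℚ) ≠ 0 := by positivity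
  apply mul_left_cancel₀ hn
  rw [add_tsub_cancel_right]
  linear_combination ((u + 1 : ℕ) : ℚ) * h1 -
    coeff n ((X * littleSchroderSeries) ^ (u + 1)) * h3

open OrderedTree

/-- The same right side as for paths. The double sum covers `k < n`; for `k = n` only the
path-shaped tree remains, and for `k > n` both sides vanish. -/
theorem mul_ncard_withGenerators_numUnary {n k : ℕ} (hk : 1 ≤ k) :
    (k : ℚ) * {t ∈ withGenerators n | t.numUnary = k - 1}.ncard =
      n.choose (k - 1) * coeff n ((X * littleSchroderSeries) ^ k) := by
  rcases lt_trichotomy k n with h | rfl | h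
  · rw [ncard_withGenerators_numUnary_eq_sum hk h, coeff_X_mul_littleSchroderSeries_pow hk h]
    ring
  · rw [ncard_withGenerators_numUnary_pred hk, coeff_X_mul_littleSchroderSeries_pow_self,
      show k.choose (k - 1) = k by
        obtain ⟨u, rfl⟩ : ∃ u, k = u + 1 := ⟨k - 1, by lia⟩
        exact Nat.choose_succ_self_right u]
  · rw [mul_pow, coeff_X_pow_mul', if_neg (by lia), mul_zero, mul_eq_zero, Nat.cast_eq_zero,
      Nat.cast_eq_zero]
    right
    convert Set.ncard_empty OrderedTree
    ext t
    simp only [Set.mem_ofPred_eq, Set.mem_empty_iff_false, iff_false, not_and]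
    intro ht h2
    have := t.numUnary_lt_numGenerators
    rw [show t.numGenerators = n from ht] at this
    lia

theorem ncard_withGenerators_numUnary_eq_ncard_peaks {n k : ℕ} (hk : 1 ≤ k) :
    {t ∈ withGenerators n | t.numUnary = k - 1}.ncard =
      {P ∈ schroderDyckPaths n | dyckPeaks P.path = k}.ncard := by
  have h : (k : ℚ) ≠ 0 := by positivity
  exact_mod_cast mul_left_cancel₀ h
    ((mul_ncard_withGenerators_numUnary hk).trans (mul_ncard_schroderDyckPaths_peaks hk).symm)

theorem finite_schroderDyckPaths (n : ℕ) : (schroderDyckPaths n).Finite :=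
  ColoredDyckPath.finite_semilength_eq _ n

theorem DyckWord.dyckPeaks_le_semilength (p : DyckWord) : dyckPeaks p ≤ p.semilength := by
  have h1 := p.isLukasiewicz_dyckRuns.add_sum_eq_length
  rw [length_dyckRuns, ← p.semilength_eq_count_D] at h1
  rw [dyckPeaks_eq_length_dyckAscents, dyckAscents_eq]
  have h2 : ∀ l : List ℕ, (l.filter fun j => 0 < j).length ≤ l.sum := by
    intro l
    induction l with
    | nil => simp
    | cons d l ih => rcases d with _ | d <;> simp_all; lia
  have := h2 (dyckRuns p.toList)
  lia

theorem DyckWord.dyckPeaks_pos {p : DyckWord} (hp : 1 ≤ p.semilength) : 1 ≤ dyckPeaks p := by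
  have h1 := p.isLukasiewicz_dyckRuns.add_sum_eq_length
  rw [length_dyckRuns, ← p.semilength_eq_count_D] at h1
  rw [dyckPeaks_eq_length_dyckAscents, dyckAscents_eq]
  by_contra h
  have h2 : (dyckRuns p.toList).filter (fun j => 0 < j) = [] :=
    List.length_eq_zero_iff.1 (by lia)
  rw [List.filter_eq_nil_iff] at h2
  have := List.sum_eq_zero (l := dyckRuns p.toList) (by simpa using h2)
  lia

open Finset in
theorem ncard_schroderDyckPaths {n : ℕ} (hn : 1 ≤ n) :
    (schroderDyckPaths n).ncard =
      ∑ u ∈ range n, {P ∈ schroderDyckPaths n | dyckPeaks P.path = u + 1}.ncard := by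
  classical
  have hfin := finite_schroderDyckPaths n
  rw [Set.ncard_eq_toFinset_card _ hfin,
    card_eq_sum_card_fiberwise (f := fun P => dyckPeaks P.path - 1) (t := range n)]
  · refine sum_congr rfl fun u _ => ?_
    rw [← Set.ncard_coe_finset]
    congr 1
    ext P
    simp only [coe_filter, Set.Finite.mem_toFinset, Set.mem_ofPred_eq]
    refine and_congr_right fun hP => ?_
    have : P.path.semilength = n := hP
    have := DyckWord.dyckPeaks_pos (p := P.path) (by lia)
    lia
  · intro P hP
    have h1 : P.path.semilength = n := hfin.mem_toFinset.1 hP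
    have := P.path.dyckPeaks_le_semilength
    simp only [coe_range, Set.mem_Iio]
    lia

/-! ### Bell polynomials and explicit values -/

/-- The partial Bell polynomial at `z i = i! * c (i - 1)` is `n! / k!` times a coefficient of the
`k`-th power of `∑ c (i - 1) * X ^ i`. -/
theorem partialBell_factorial_mul {n k : ℕ} (hkn : k ≤ n) (c : ℕ → ℚ) :
    partialBell n k (fun i => (i.factorial : ℚ) * c (i - 1)) =
      (n.factorial / k.factorial : ℚ) * coeff n ((X * mk c) ^ k) := by
  -- In a product of `k` terms of positive degree and total degree `n`, no degree exceeds `n - k +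
  -- 1`; truncating there makes the multinomial theorem applicable.
  have h1 : coeff n ((X * mk c) ^ k) =
      coeff n ((∑ i ∈ Finset.Icc 1 (n - k + 1), monomial i (c (i - 1))) ^ k) := by
    have h2 : (∑ i ∈ Finset.Icc 1 (n - k + 1), monomial i (c (i - 1))) =
        X * (trunc (n - k + 1) (mk c) : PowerSeries ℚ) := by
      ext m
      rw [map_sum]
      simp only [coeff_monomial, Finset.sum_ite_eq, Finset.mem_Icc]
      cases m with
      | zero => simp
      | succ m =>
        rw [coeff_succ_X_mul, Polynomial.coeff_coe, coeff_trunc, coeff_mk]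
        simp
    rw [h2, mul_pow, mul_pow, coeff_X_pow_mul', coeff_X_pow_mul', if_pos hkn, if_pos hkn]
    have h3 := congrArg (fun p => Polynomial.coeff p (n - k))
      (trunc_trunc_pow (mk c) (n - k + 1) k)
    simp only [coeff_trunc] at h3
    simpa using h3.symm
  rw [h1, Finset.sum_pow_eq_sum_piAntidiag, map_sum, Finset.mul_sum, partialBell,
    Finset.sum_filter]
  refine Finset.sum_congr rfl fun α hα => ?_
  rw [Finset.mem_piAntidiag] at hα
  have h4 : ∏ i ∈ Finset.Icc 1 (n - k + 1), monomial i (c (i - 1)) ^ α i =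
      monomial (∑ i ∈ Finset.Icc 1 (n - k + 1), i * α i)
        (∏ i ∈ Finset.Icc 1 (n - k + 1), c (i - 1) ^ α i) := by
    simp only [monomial_eq_C_mul_X_pow, mul_pow, Finset.prod_mul_distrib, ← pow_mul, map_prod,
      map_pow, Finset.prod_pow_eq_pow_sum]
  rw [h4, ← nsmul_eq_mul, map_nsmul, coeff_monomial, nsmul_eq_mul]
  simp only [eq_comm (a := n)]
  split_ifs with h5
  · have h6 := Nat.multinomial_spec (Finset.Icc 1 (n - k + 1)) α
    rw [hα.1] at h6
    have h7 : (∏ i ∈ Finset.Icc 1 (n - k + 1), ((α i).factorial : ℚ)) *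
        Nat.multinomial (Finset.Icc 1 (n - k + 1)) α = k.factorial := by exact_mod_cast h6
    have h8 : (∏ i ∈ Finset.Icc 1 (n - k + 1), ((α i).factorial : ℚ)) ≠ 0 :=
      Finset.prod_ne_zero_iff.2 fun i _ => by positivity
    have h9 : (k.factorial : ℚ) ≠ 0 := by positivity
    rw [← h7] at h9 ⊢
    have h10 : ∀ i, ((i.factorial : ℚ) * c (i - 1)) / i.factorial = c (i - 1) := fun i =>
      mul_div_cancel_left₀ _ (by positivity)
    simp only [h10]
    field_simp
    rw [mul_div_cancel_right₀ _ (right_ne_zero_of_mul h9)]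
  · simp

/-- The number of trees with `n` generators as a double sum. -/
theorem ncard_withGenerators_eq_sum {n : ℕ} (hn : 1 ≤ n) :
    ((withGenerators n).ncard : ℚ) =
      1 + ∑ k ∈ Finset.Icc 1 (n - 1), ∑ j ∈ Finset.Icc 1 (n - k),
        (1 / (j : ℚ)) * (n.choose (k - 1) : ℚ) * ((n - k - 1).choose (j - 1) : ℚ) *
          ((n + j - 1).choose (j - 1) : ℚ) := by
  obtain ⟨m, rfl⟩ : ∃ m, n = m + 1 := ⟨n - 1, by lia⟩
  have h1 := ncard_withGenerators_numUnary_pred (n := m + 1) (by lia)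
  rw [add_tsub_cancel_right] at h1
  rw [ncard_withGenerators, Finset.sum_range_succ]
  push_cast
  rw [h1, add_comm]
  congr 1
  refine Finset.sum_bij' (fun u _ => u + 1) (fun k _ => k - 1) ?_ ?_ ?_ ?_ ?_ <;>
    simp only [Finset.mem_range, Finset.mem_Icc] <;> intro u hu
  · lia
  · lia
  · lia
  · lia
  · have h2 := ncard_withGenerators_numUnary_eq_sum (n := m + 1) (k := u + 1) (by lia) (by lia)
    rw [add_tsub_cancel_right] at h2
    rw [h2, Finset.mul_sum]
    refine Finset.sum_congr rfl fun j _ => ?_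
    rw [add_tsub_cancel_right]
    ring

theorem ncard_withGenerators_values :
    (List.range 8).map (fun i => (withGenerators (i + 1)).ncard) =
      [1, 2, 7, 32, 166, 926, 5419, 32816] := by
  have h (n v : ℕ) (hn : 1 ≤ n)
      (hv : 1 + ∑ k ∈ Finset.Icc 1 (n - 1), ∑ j ∈ Finset.Icc 1 (n - k),
        (1 / (j : ℚ)) * (n.choose (k - 1) : ℚ) * ((n - k - 1).choose (j - 1) : ℚ) *
          ((n + j - 1).choose (j - 1) : ℚ) = v) : (withGenerators n).ncard = v := by
    rw [← ncard_withGenerators_eq_sum hn] at hv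
    exact_mod_cast hv
  rw [show List.range 8 = [0, 1, 2, 3, 4, 5, 6, 7] from rfl]
  simp only [List.map_cons, List.map_nil, Nat.reduceAdd]
  rw [h 1 1, h 2 2, h 3 7, h 4 32, h 5 166, h 6 926, h 7 5419, h 8 32816] <;>
    norm_num [Finset.sum_Icc_succ_top, Nat.choose]

end

theorem mainTheorem9 :
    (∀ n : ℕ, 1 ≤ n →
      (OrderedTree.withGenerators n).Finite ∧
      (schroderDyckPaths n).Finite ∧
      (OrderedTree.withGenerators n).ncard = (schroderDyckPaths n).ncard ∧
      ((OrderedTree.withGenerators n).ncard : ℚ) =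
        1 + ∑ k ∈ Finset.Icc 1 (n - 1), ∑ j ∈ Finset.Icc 1 (n - k),
          (1 / (j : ℚ)) * (n.choose (k - 1) : ℚ) * ((n - k - 1).choose (j - 1) : ℚ) *
            ((n + j - 1).choose (j - 1) : ℚ) ∧
      (∀ k : ℕ, 1 ≤ k →
        {t ∈ OrderedTree.withGenerators n | t.numUnary = k - 1}.ncard =
          {P ∈ schroderDyckPaths n | dyckPeaks P.path = k}.ncard) ∧
      (∀ k : ℕ, 1 ≤ k → k ≤ n →
        ({t ∈ OrderedTree.withGenerators n | t.numUnary = k - 1}.ncard : ℚ) =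
          (n.choose (k - 1) : ℚ) * (((k - 1).factorial : ℚ) / (n.factorial : ℚ)) *
            partialBell n k (fun i => (i.factorial : ℚ) * (littleSchroder (i - 1) : ℚ))) ∧
      (∀ k : ℕ, 1 ≤ k → k < n →
        ({t ∈ OrderedTree.withGenerators n | t.numUnary = k - 1}.ncard : ℚ) =
          (n.choose (k - 1) : ℚ) *
            ∑ j ∈ Finset.Icc 1 (n - k),
              (1 / (j : ℚ)) * ((n - k - 1).choose (j - 1) : ℚ) *
                ((n + j - 1).choose (j - 1) : ℚ))) ∧
    (List.range 8).map (fun i => (OrderedTree.withGenerators (i + 1)).ncard) =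
      [1, 2, 7, 32, 166, 926, 5419, 32816] := by
  refine ⟨fun n hn => ⟨OrderedTree.finite_withGenerators n, finite_schroderDyckPaths n, ?_,
    ncard_withGenerators_eq_sum hn, fun k hk => ncard_withGenerators_numUnary_eq_ncard_peaks hk,
    fun k hk hkn => ?_, fun k hk hkn => ?_⟩, ncard_withGenerators_values⟩
  · rw [OrderedTree.ncard_withGenerators, ncard_schroderDyckPaths hn]
    exact Finset.sum_congr rfl fun u _ =>
      ncard_withGenerators_numUnary_eq_ncard_peaks (k := u + 1) (by lia)
  · rw [partialBell_factorial_mul hkn fun i => (littleSchroder i : ℚ)]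
    have h1 := mul_ncard_withGenerators_numUnary (n := n) hk
    obtain ⟨u, rfl⟩ : ∃ u, k = u + 1 := ⟨k - 1, by lia⟩
    have h2 : ((u + 1 : ℕ) : ℚ) ≠ 0 := by positivity
    have h3 : (u.factorial : ℚ) ≠ 0 := by positivity
    have h4 : (n.factorial : ℚ) ≠ 0 := by positivity
    apply mul_left_cancel₀ h2
    -- The factorials `(k-1)!/n!` and `n!/k!` combine to `1/k`.
    rw [h1, add_tsub_cancel_right, Nat.factorial_succ, ← littleSchroderSeries]
    push_cast at h2 ⊢
    field_simp
  · exact OrderedTree.ncard_withGenerators_numUnary_eq_sum hk hkn
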